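/- Let $\gamma_0,\gamma_1$ be nonzero real numbers. Let $\psi_t(x)\in\mathbb{C}$ ($t\ge 0$, $x\in\mathbb{Z}_{\ge 0}$) be the probability amplitude, i.e. $\sum_{x\ge 0}|\psi_t(x)|^2=1$ for every $t\ge 0$, of the continuous-time quantum walk on the half line with $\psi_0(0)=1$ and $\psi_0(x)=0$ for $x\ge 1$ which evolves by the Schrödinger equation \begin{align*} i\,\tfrac{d}{dt}\psi_t(0)&=\gamma_0\,\psi_t(1),\\ i\,\tfrac{d}{dt}\psi_t(2n)&=\gamma_1\,\psi_t(2n-1)+\gamma_0\,\psi_t(2n+1)\qquad(n=1,2,\ldots),\\ i\,\tfrac{d}{dt}\psi_t(2n+1)&=\gamma_0\,\psi_t(2n)+\gamma_1\,\psi_t(2n+2)\qquad(n=0,1,2,\ldots), \end{align*} and let $\mathbb{P}(X_t=x)=|\psi_t(x)|^2$ be the probability that the walker is found at $x$ at time $t$. Then for every $n=0,1,2,\ldots$ \[ \lim_{t\to\infty}\mathbb{P}(X_t=2n)=\begin{cases}\bigl(1-(\gamma_0/\gamma_1)^2\bigr)^2(\gamma_0/\gamma_1)^{2n} & \text{if }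 |\gamma_0|<|\gamma_1|,\\ 0 & \text{if } |\gamma_0|\ge|\gamma_1|,\end{cases} \qquad \lim_{t\to\infty}\mathbb{P}(X_t=2n+1)=0 . \] In particular, the walk is localized, meaning that $\lim_{t\to\infty}\mathbb{P}(X_t=x)>0$ for some $x\in\mathbb{Z}_{\ge 0}$, if and only if $|\gamma_0|<|\gamma_1|$. -/

import Mathlib

open Filter Topology

/-- `ψ t x` (for `t ≥ 0`, `x = 0, 1, 2, …`) is the probability amplitude of the continuous-time
quantum walk on the half line with the 2-periodic Hamiltonian given by `γ₀, γ₁`, launched at `0`.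
Being a probability amplitude means that the squared moduli sum to `1` at each time.
The derivative at `t = 0` is one-sided. -/
structure IsHalfLineWalk (γ₀ γ₁ : ℝ) (ψ : ℝ → ℕ → ℂ) : Prop where
  /-- at each time, `|ψ t x|²` is a probability distribution in `x` -/
  normalized : ∀ t : ℝ, 0 ≤ t → HasSum (fun x : ℕ => ‖ψ t x‖ ^ 2) 1
  /-- localized initial state -/
  initial : ∀ x : ℕ, ψ 0 x = if x = 0 then 1 else 0
  /-- `i dψ(0)/dt = γ₀ ψ(1)` -/
  edge : ∀ t : ℝ, 0 ≤ t →
    HasDerivWithinAt (fun s => Complex.I * ψ s 0) (γ₀ * ψ t 1) (Set.Ici 0) t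
  /-- `i dψ(2n)/dt = γ₁ ψ(2n-1) + γ₀ ψ(2n+1)` for `n ≥ 1` -/
  even : ∀ t : ℝ, 0 ≤ t → ∀ n : ℕ, 1 ≤ n →
    HasDerivWithinAt (fun s => Complex.I * ψ s (2 * n))
      (γ₁ * ψ t (2 * n - 1) + γ₀ * ψ t (2 * n + 1)) (Set.Ici 0) t
  /-- `i dψ(2n+1)/dt = γ₀ ψ(2n) + γ₁ ψ(2n+2)` for `n ≥ 0` -/
  odd : ∀ t : ℝ, 0 ≤ t → ∀ n : ℕ,
    HasDerivWithinAt (fun s => Complex.I * ψ s (2 * n + 1))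
      (γ₀ * ψ t (2 * n) + γ₁ * ψ t (2 * n + 2)) (Set.Ici 0) t

/-- The probability `ℙ(X_t = x)` of finding the walker at `x` at time `t`. -/
noncomputable def findProb (ψ : ℝ → ℕ → ℂ) (t : ℝ) (x : ℕ) : ℝ := ‖ψ t x‖ ^ 2

/-- Localization: at some site the finding probability has a positive long-time limit. -/
def IsLocalized (ψ : ℝ → ℕ → ℂ) : Prop :=
  ∃ (x : ℕ) (p : ℝ), 0 < p ∧ Tendsto (fun t : ℝ => findProb ψ t x) atTop (𝓝 p)

/-!
The odd sites carry no zero mode: on them the square of the Hamiltonian is the Dirichlet Toeplitz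
operator with symbol `E(k)² = γ₀² + γ₁² + 2 γ₀ γ₁ cos k`, diagonalized by the sine modes
`sin ((n + 1) k)`. Solving the wave equation there and integrating once in time for the even sites
gives explicit amplitudes `oddAmp` and `evenAmp` as integrals over `k ∈ (0, π)` of `sin (t E) / E`
and `(1 - cos (t E)) / E²`. They solve the Schrödinger equation by differentiation under the
integral and orthogonality of the sine modes, and they are the only solution that is bounded in the
site on bounded time intervals (`eq_zero_of_norm_deriv_le_sup`), so any walk is given by them
(`IsHalfLineWalk.eq_walkAmp`).

As `E` is injective without critical points on `(0, π)`, taking `E` as the variable and applying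
the Riemann–Lebesgue lemma (`tendsto_setIntegral_cexp_phase`) removes the oscillating terms as
`t → ∞`: the odd amplitudes vanish and the even ones tend to `evenLimit`. The limiting
configuration is a zero mode, that is, a multiple of `(-γ₀ / γ₁) ^ n` (`evenLimit_eq_pow_mul`).
The multiple is determined by the integral of `sin² k / E²`, which is symmetric in `γ₀, γ₁`.
If `|γ₁| < |γ₀|` the zero mode grows whereas the limit is bounded, so the multiple is `0` and the
integral is `π / (2 γ₀²)`; by symmetry it is `π / (2 γ₁²)` if `|γ₀| < |γ₁|`, which makes the
multiple `1 - (γ₀ / γ₁)²`. In the critical case `|γ₀| = |γ₁|` the integral is elementary, and the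
multiple is again `0`.
-/

open MeasureTheory Set

/-! ### Uniqueness for lattice evolutions of finite propagation speed -/

/-- Uniqueness for a lattice evolution whose velocity at each site is at most `c` times the
supremum of the current configuration. Integrating the a priori bound `n` times improves it to
`M (c t) ^ n / n!`, which tends to `0`; no summability in the sites is needed. -/
theorem eq_zero_of_norm_deriv_le_sup {X F : Type*} [NormedAddCommGroup F] [NormedSpace ℝ F]
    {u v : ℝ → X → F} {c M T : ℝ} (h0 : ∀ x, u 0 x = 0)
    (hd : ∀ t, 0 ≤ t → ∀ x, HasDerivWithinAt (fun s => u s x) (v t x) (Ici 0) t)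
    (hv : ∀ t, 0 ≤ t → ∀ B, (∀ y, ‖u t y‖ ≤ B) → ∀ x, ‖v t x‖ ≤ c * B)
    (hM : ∀ t ∈ Icc 0 T, ∀ x, ‖u t x‖ ≤ M) {t : ℝ} (ht : t ∈ Icc 0 T) (x : X) :
    u t x = 0 := by
  have key : ∀ n : ℕ, ∀ t ∈ Icc 0 T, ∀ x, ‖u t x‖ ≤ M * ((c * t) ^ n / n.factorial) := by
    intro n
    induction n with
    | zero => simpa using hM
    | succ n ih =>
      intro t ht x
      refine image_norm_le_of_norm_deriv_right_le_deriv_boundary (a := 0) (b := T)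
        (f := fun s => u s x) (f' := fun s => v s x)
        (B := fun s => M * ((c * s) ^ (n + 1) / (n + 1).factorial))
        (B' := fun s => c * (M * ((c * s) ^ n / n.factorial)))
        (fun s hs => ((hd s hs.1 x).mono Icc_subset_Ici_self).continuousWithinAt)
        (fun s hs => (hd s hs.1 x).mono (Ici_subset_Ici.2 hs.1)) (by simp [h0]) (fun s => ?_)
        (fun s hs => hv s hs.1 _ (fun y => ih s (Ico_subset_Icc_self hs) y) x) ht
      have h1 : HasDerivAt (fun s : ℝ => c * s) c s := by
        simpa using (hasDerivAt_id s).const_mul c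
      have h2 := ((h1.pow (n + 1)).div_const ((n + 1).factorial : ℝ)).const_mul M
      refine h2.congr_deriv ?_
      have : (n.factorial : ℝ) ≠ 0 := by positivity
      rw [Nat.factorial_succ]
      push_cast
      field_simp
  have hlim : Tendsto (fun n : ℕ => M * ((c * t) ^ n / n.factorial)) atTop (𝓝 (M * 0)) :=
    (FloorSemiring.tendsto_pow_div_factorial_atTop (c * t)).const_mul M
  have := ge_of_tendsto' hlim (fun n => key n t ht x)
  simpa using this

/-! ### Oscillatory integrals without stationary points -/

/-- Riemann–Lebesgue lemma for an injective phase `f` without critical points on `s`: the change of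
variables `y = f x` turns the integral into a Fourier transform. -/
theorem tendsto_setIntegral_cexp_phase {s : Set ℝ} (hs : MeasurableSet s) {f f' : ℝ → ℝ}
    (hf : ∀ x ∈ s, HasDerivWithinAt f (f' x) s x) (hinj : InjOn f s) (hf' : ∀ x ∈ s, f' x ≠ 0)
    (g : ℝ → ℝ) :
    Tendsto (fun t : ℝ => ∫ x in s, Complex.exp ((t * f x : ℝ) * Complex.I) * g x)
      atTop (𝓝 0) := by
  have himg : MeasurableSet (f '' s) :=
    measurable_image_of_fderivWithin hs (fun x hx => (hf x hx).hasFDerivWithinAt) hinj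
  set i := Function.invFunOn f s with hi
  have hleft : ∀ x ∈ s, i (f x) = x := hinj.leftInvOn_invFunOn
  set h : ℝ → ℂ := (f '' s).indicator fun y => ((g (i y) / |f' (i y)| : ℝ) : ℂ) with hh
  have hRL := Real.tendsto_integral_exp_smul_cocompact h
  have hpi := Real.pi_pos
  have hw : Tendsto (fun t : ℝ => -(2 * Real.pi)⁻¹ * t) atTop (cocompact ℝ) := by
    refine Tendsto.mono_right ?_ atBot_le_cocompact
    exact tendsto_id.const_mul_atTop_of_neg (by simpa using hpi)
  refine (hRL.comp hw).congr fun t => ?_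
  simp only [Function.comp]
  have e1 : ∀ v : ℝ, Real.fourierChar (-(v * (-(2 * Real.pi)⁻¹ * t))) • h v =
      (f '' s).indicator (fun y => Complex.exp ((t * y : ℝ) * Complex.I) *
        ((g (i y) / |f' (i y)| : ℝ) : ℂ)) v := by
    intro v
    by_cases hv : v ∈ f '' s
    · rw [hh, indicator_of_mem hv, indicator_of_mem hv, Circle.smul_def, Real.fourierChar_apply,
        smul_eq_mul]
      congr 4
      field_simp
    · rw [hh, indicator_of_notMem hv, indicator_of_notMem hv, smul_zero]
  simp_rw [e1]
  rw [integral_indicator himg, integral_image_eq_integral_abs_deriv_smul hs hf hinj]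
  refine setIntegral_congr_fun hs fun x hx => ?_
  have h1 : |f' x| ≠ 0 := abs_ne_zero.2 (hf' x hx)
  have h2 : ((|f' x| : ℝ) : ℂ) ≠ 0 := by exact_mod_cast h1
  simp only [hleft x hx, Complex.real_smul, Complex.ofReal_div]
  field_simp

theorem integrableOn_cexp_phase {s : Set ℝ} (hs : MeasurableSet s) {f f' : ℝ → ℝ}
    (hf : ∀ x ∈ s, HasDerivWithinAt f (f' x) s x) {g : ℝ → ℝ} (hg : IntegrableOn g s) (t : ℝ) :
    IntegrableOn (fun x => Complex.exp ((t * f x : ℝ) * Complex.I) * g x) s := by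
  have hfm : AEMeasurable f (volume.restrict s) :=
    ContinuousOn.aemeasurable (fun x hx => (hf x hx).continuousWithinAt) hs
  refine (Integrable.ofReal hg).bdd_mul (c := 1) ?_ ?_
  · exact (Complex.measurable_exp.comp_aemeasurable
      ((Complex.measurable_ofReal.comp_aemeasurable (hfm.const_mul t)).mul_const
        Complex.I)).aestronglyMeasurable
  · exact Eventually.of_forall fun x => (Complex.norm_exp_ofReal_mul_I _).le

theorem tendsto_setIntegral_cos_phase {s : Set ℝ} (hs : MeasurableSet s) {f f' : ℝ → ℝ}
    (hf : ∀ x ∈ s, HasDerivWithinAt f (f' x) s x) (hinj : InjOn f s) (hf' : ∀ x ∈ s, f' x ≠ 0)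
    {g : ℝ → ℝ} (hg : IntegrableOn g s) :
    Tendsto (fun t : ℝ => ∫ x in s, Real.cos (t * f x) * g x) atTop (𝓝 0) := by
  have := (Complex.continuous_re.tendsto 0).comp
    (tendsto_setIntegral_cexp_phase hs hf hinj hf' g)
  rw [Complex.zero_re] at this
  refine this.congr fun t => ?_
  have e := (Complex.reCLM.integral_comp_comm (integrableOn_cexp_phase hs hf hg t)).symm
  simp only [Complex.reCLM_apply, Complex.mul_re, Complex.ofReal_re, Complex.ofReal_im,
    mul_zero, sub_zero, Complex.exp_ofReal_mul_I_re] at e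
  exact e

theorem tendsto_setIntegral_sin_phase {s : Set ℝ} (hs : MeasurableSet s) {f f' : ℝ → ℝ}
    (hf : ∀ x ∈ s, HasDerivWithinAt f (f' x) s x) (hinj : InjOn f s) (hf' : ∀ x ∈ s, f' x ≠ 0)
    {g : ℝ → ℝ} (hg : IntegrableOn g s) :
    Tendsto (fun t : ℝ => ∫ x in s, Real.sin (t * f x) * g x) atTop (𝓝 0) := by
  have := (Complex.continuous_im.tendsto 0).comp
    (tendsto_setIntegral_cexp_phase hs hf hinj hf' g)
  rw [Complex.zero_im] at this
  refine this.congr fun t => ?_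
  have e := (Complex.imCLM.integral_comp_comm (integrableOn_cexp_phase hs hf hg t)).symm
  simp only [Complex.imCLM_apply, Complex.mul_im, Complex.ofReal_re, Complex.ofReal_im,
    mul_zero, zero_add, Complex.exp_ofReal_mul_I_im] at e
  exact e

/-! ### Differentiating wave propagators in time -/

theorem abs_sin_mul_div_le (t e : ℝ) : |Real.sin (t * e) / e| ≤ |t| := by
  rcases eq_or_ne e 0 with rfl | he
  · simp
  rw [abs_div, div_le_iff₀ (abs_pos.2 he), ← abs_mul]
  exact Real.abs_sin_le_abs

theorem abs_one_sub_cos_mul_div_le (t e : ℝ) : |(1 - Real.cos (t * e)) / e ^ 2| ≤ t ^ 2 / 2 := by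
  rcases eq_or_ne e 0 with rfl | he
  · simp; positivity
  have he2 : 0 < e ^ 2 := by positivity
  rw [abs_of_nonneg (div_nonneg (by linarith [Real.cos_le_one (t * e)]) he2.le),
    div_le_iff₀ he2]
  have := Real.one_sub_sq_div_two_le_cos (x := t * e)
  nlinarith

section
variable {α : Type*} [MeasurableSpace α] {μ : Measure α} {E g : α → ℝ}

theorem integrable_sin_mul_div (hE : AEMeasurable E μ) (hg : Integrable g μ) (t : ℝ) :
    Integrable (fun k => Real.sin (t * E k) / E k * g k) μ :=
  hg.bdd_mul (c := |t|)
    ((Real.measurable_sin.comp_aemeasurable (hE.const_mul t)).div hE).aestronglyMeasurable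
    (Eventually.of_forall fun k => abs_sin_mul_div_le t (E k))

theorem integrable_one_sub_cos_mul_div (hE : AEMeasurable E μ) (hg : Integrable g μ) (t : ℝ) :
    Integrable (fun k => (1 - Real.cos (t * E k)) / E k ^ 2 * g k) μ :=
  hg.bdd_mul (c := t ^ 2 / 2)
    (((Real.measurable_cos.comp_aemeasurable (hE.const_mul t)).const_sub 1).div
      (hE.pow_const 2)).aestronglyMeasurable
    (Eventually.of_forall fun k => abs_one_sub_cos_mul_div_le t (E k))

theorem integrable_cos_mul (hE : AEMeasurable E μ) (hg : Integrable g μ) (t : ℝ) :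
    Integrable (fun k => Real.cos (t * E k) * g k) μ :=
  hg.bdd_mul (c := 1)
    (Real.measurable_cos.comp_aemeasurable (hE.const_mul t)).aestronglyMeasurable
    (Eventually.of_forall fun _ => Real.abs_cos_le_one _)

theorem hasDerivAt_integral_sin_mul_div (hE : AEMeasurable E μ) (hE0 : ∀ᵐ k ∂μ, E k ≠ 0)
    (hg : Integrable g μ) (t : ℝ) :
    HasDerivAt (fun t => ∫ k, Real.sin (t * E k) / E k * g k ∂μ)
      (∫ k, Real.cos (t * E k) * g k ∂μ) t := by
  refine (hasDerivAt_integral_of_dominated_loc_of_deriv_le (bound := fun k => |g k|)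
    (F' := fun t k => Real.cos (t * E k) * g k) univ_mem
    (Eventually.of_forall fun t => (integrable_sin_mul_div hE hg t).aestronglyMeasurable)
    (integrable_sin_mul_div hE hg t) (integrable_cos_mul hE hg t).aestronglyMeasurable
    (Eventually.of_forall fun k t _ => ?_) hg.abs ?_).2
  · rw [Real.norm_eq_abs, abs_mul]
    exact mul_le_of_le_one_left (abs_nonneg _) (Real.abs_cos_le_one _)
  · filter_upwards [hE0] with k hk t _
    have h1 : HasDerivAt (fun t : ℝ => t * E k) (E k) t := by
      simpa using (hasDerivAt_id t).mul_const (E k)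
    refine ((h1.sin.div_const (E k)).mul_const (g k)).congr_deriv ?_
    field_simp

theorem hasDerivAt_integral_one_sub_cos_mul_div (hE : AEMeasurable E μ)
    (hE0 : ∀ᵐ k ∂μ, E k ≠ 0) (hg : Integrable g μ) (t : ℝ) :
    HasDerivAt (fun t => ∫ k, (1 - Real.cos (t * E k)) / E k ^ 2 * g k ∂μ)
      (∫ k, Real.sin (t * E k) / E k * g k ∂μ) t := by
  refine (hasDerivAt_integral_of_dominated_loc_of_deriv_le
    (bound := fun k => (|t| + 1) * |g k|)
    (F' := fun t k => Real.sin (t * E k) / E k * g k) (Metric.ball_mem_nhds t one_pos)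
    (Eventually.of_forall fun t =>
      (integrable_one_sub_cos_mul_div hE hg t).aestronglyMeasurable)
    (integrable_one_sub_cos_mul_div hE hg t) (integrable_sin_mul_div hE hg t).aestronglyMeasurable
    (Eventually.of_forall fun k r hr => ?_) (hg.abs.const_mul _) ?_).2
  · rw [Real.norm_eq_abs, abs_mul]
    refine mul_le_mul_of_nonneg_right ((abs_sin_mul_div_le r (E k)).trans ?_) (abs_nonneg _)
    rw [Metric.mem_ball, Real.dist_eq] at hr
    linarith [abs_sub_abs_le_abs_sub r t]
  · filter_upwards [hE0] with k hk t _
    have h1 : HasDerivAt (fun t : ℝ => t * E k) (E k) t := by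
      simpa using (hasDerivAt_id t).mul_const (E k)
    refine (((h1.cos.const_sub 1).div_const (E k ^ 2)).mul_const (g k)).congr_deriv ?_
    field_simp
end

/-! ### The dispersion relation and the sine modes of the odd sublattice -/

/-- The positive branch of the dispersion relation of the 2-periodic Hamiltonian, as a function of
the quasimomentum `k`: the square of the Hamiltonian acts on the odd sites as the Dirichlet
Toeplitz operator with symbol `γ₀² + γ₁² + 2 γ₀ γ₁ cos k`. -/
noncomputable def bandEnergy (γ₀ γ₁ k : ℝ) : ℝ :=
  √(γ₀ ^ 2 + γ₁ ^ 2 + 2 * γ₀ * γ₁ * Real.cos k)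

/-- The product of the `n`-th and the first sine mode. The odd site `2 n + 1` carries the mode
`n + 1`, so that `n = 0` encodes the Dirichlet condition to the left of the origin. -/
noncomputable def sinProd (n : ℕ) (k : ℝ) : ℝ := Real.sin (n * k) * Real.sin k

theorem continuous_bandEnergy (γ₀ γ₁ : ℝ) : Continuous (bandEnergy γ₀ γ₁) := by
  unfold bandEnergy; fun_prop

theorem bandEnergy_comm (γ₀ γ₁ k : ℝ) : bandEnergy γ₀ γ₁ k = bandEnergy γ₁ γ₀ k := by
  unfold bandEnergy; congr 1; ring

theorem sq_bandEnergy (γ₀ γ₁ k : ℝ) :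
    bandEnergy γ₀ γ₁ k ^ 2 = γ₀ ^ 2 + γ₁ ^ 2 + 2 * γ₀ * γ₁ * Real.cos k := by
  refine Real.sq_sqrt ?_
  nlinarith [sq_nonneg (γ₀ + γ₁ * Real.cos k), sq_nonneg (γ₁ * Real.sin k),
    Real.sin_sq_add_cos_sq k]

theorem mul_sin_sq_le_sq_bandEnergy (γ₀ γ₁ k : ℝ) :
    γ₁ ^ 2 * Real.sin k ^ 2 ≤ bandEnergy γ₀ γ₁ k ^ 2 := by
  rw [sq_bandEnergy]
  nlinarith [sq_nonneg (γ₀ + γ₁ * Real.cos k), Real.sin_sq_add_cos_sq k]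

theorem bandEnergy_pos {γ₀ γ₁ k : ℝ} (h₁ : γ₁ ≠ 0) (hk : k ∈ Ioo 0 Real.pi) :
    0 < bandEnergy γ₀ γ₁ k := by
  have h := mul_sin_sq_le_sq_bandEnergy γ₀ γ₁ k
  have hs := Real.sin_pos_of_mem_Ioo hk
  have h2 : 0 < γ₁ ^ 2 * Real.sin k ^ 2 := by positivity
  exact lt_of_le_of_ne (Real.sqrt_nonneg _) fun h0 => by
    rw [← h0] at h
    norm_num at h
    linarith

theorem hasDerivAt_bandEnergy {γ₀ γ₁ k : ℝ} (h₁ : γ₁ ≠ 0) (hk : k ∈ Ioo 0 Real.pi) :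
    HasDerivAt (bandEnergy γ₀ γ₁)
      (-(2 * γ₀ * γ₁ * Real.sin k) / (2 * bandEnergy γ₀ γ₁ k)) k := by
  have h : HasDerivAt (fun k => γ₀ ^ 2 + γ₁ ^ 2 + 2 * γ₀ * γ₁ * Real.cos k)
      (-(2 * γ₀ * γ₁ * Real.sin k)) k :=
    (((Real.hasDerivAt_cos k).const_mul (2 * γ₀ * γ₁)).const_add _).congr_deriv (by ring)
  refine h.sqrt ?_
  rw [← sq_bandEnergy]
  exact (pow_pos (bandEnergy_pos h₁ hk) 2).ne'

theorem injOn_bandEnergy {γ₀ γ₁ : ℝ} (h₀ : γ₀ ≠ 0) (h₁ : γ₁ ≠ 0) :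
    InjOn (bandEnergy γ₀ γ₁) (Ioo 0 Real.pi) := by
  intro x hx y hy h
  have h2 := congrArg (· ^ 2) h
  simp only [sq_bandEnergy] at h2
  refine Real.injOn_cos (Ioo_subset_Icc_self hx) (Ioo_subset_Icc_self hy) ?_
  have : γ₀ * γ₁ ≠ 0 := mul_ne_zero h₀ h₁
  exact mul_left_cancel₀ this (by linarith)

theorem continuous_sinProd (n : ℕ) : Continuous (sinProd n) := by
  unfold sinProd; fun_prop

theorem sinProd_zero (k : ℝ) : sinProd 0 k = 0 := by simp [sinProd]

theorem abs_sinProd_le_one (n : ℕ) (k : ℝ) : |sinProd n k| ≤ 1 := by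
  rw [sinProd, abs_mul]
  exact mul_le_one₀ (Real.abs_sin_le_one _) (abs_nonneg _) (Real.abs_sin_le_one _)

theorem abs_sin_nat_mul_le (n : ℕ) (k : ℝ) : |Real.sin (n * k)| ≤ n * |Real.sin k| := by
  induction n with
  | zero => simp
  | succ n ih =>
    push_cast
    rw [add_mul, one_mul, Real.sin_add]
    refine (abs_add_le _ _).trans ?_
    rw [abs_mul, abs_mul]
    have h1 := mul_le_of_le_one_right (abs_nonneg (Real.sin (n * k))) (Real.abs_cos_le_one k)
    have h2 := mul_le_of_le_one_left (abs_nonneg (Real.sin k)) (Real.abs_cos_le_one (n * k))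
    linarith

theorem integrableOn_of_continuous {f : ℝ → ℝ} (hf : Continuous f) :
    IntegrableOn f (Ioo 0 Real.pi) :=
  (hf.integrableOn_Icc (a := 0) (b := Real.pi)).mono_set Ioo_subset_Icc_self

theorem integrableOn_sinProd (n : ℕ) : IntegrableOn (sinProd n) (Ioo 0 Real.pi) :=
  integrableOn_of_continuous (continuous_sinProd n)

theorem setIntegral_cos_nat_mul (n : ℕ) :
    ∫ k in Ioo 0 Real.pi, Real.cos (n * k) = if n = 0 then Real.pi else 0 := by
  rw [← integral_Ioc_eq_integral_Ioo, ← intervalIntegral.integral_of_le Real.pi_pos.le]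
  split_ifs with h
  · simp [h]
  · have : (n : ℝ) ≠ 0 := by exact_mod_cast h
    rw [intervalIntegral.integral_comp_mul_left (fun x => Real.cos x) this]
    simp [Real.sin_nat_mul_pi]

/-- Orthogonality of the sine modes. -/
theorem setIntegral_sinProd_succ (n : ℕ) :
    ∫ k in Ioo 0 Real.pi, sinProd (n + 1) k = if n = 0 then Real.pi / 2 else 0 := by
  have e : ∀ k, sinProd (n + 1) k
      = 1 / 2 * (Real.cos (n * k) - Real.cos (((n + 2 : ℕ) : ℝ) * k)) := by
    intro k
    have h1 : (n : ℝ) * k = ((n + 1 : ℕ) : ℝ) * k - k := by push_cast; ring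
    have h2 : ((n + 2 : ℕ) : ℝ) * k = ((n + 1 : ℕ) : ℝ) * k + k := by push_cast; ring
    rw [h1, h2, Real.cos_sub, Real.cos_add, sinProd]
    ring
  simp_rw [e]
  rw [integral_const_mul, integral_sub (integrableOn_of_continuous (by fun_prop))
    (integrableOn_of_continuous (by fun_prop)), setIntegral_cos_nat_mul, setIntegral_cos_nat_mul,
    if_neg (Nat.succ_ne_zero (n + 1))]
  split_ifs <;> ring

theorem sinProd_add_sinProd (n : ℕ) (k : ℝ) :
    sinProd n k + sinProd (n + 2) k = 2 * Real.cos k * sinProd (n + 1) k := by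
  have h1 : (n : ℝ) * k = ((n + 1 : ℕ) : ℝ) * k - k := by push_cast; ring
  have h2 : ((n + 2 : ℕ) : ℝ) * k = ((n + 1 : ℕ) : ℝ) * k + k := by push_cast; ring
  rw [sinProd, sinProd, sinProd, h1, h2, Real.sin_sub, Real.sin_add]
  ring

/-- The image of the sine mode under the Hamiltonian, at the even site `2 n`, times `sin k`. -/
noncomputable def evenMode (γ₀ γ₁ : ℝ) (n : ℕ) (k : ℝ) : ℝ :=
  γ₁ * sinProd n k + γ₀ * sinProd (n + 1) k

theorem integrableOn_evenMode (γ₀ γ₁ : ℝ) (n : ℕ) :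
    IntegrableOn (evenMode γ₀ γ₁ n) (Ioo 0 Real.pi) :=
  ((integrableOn_sinProd n).const_mul γ₁).add ((integrableOn_sinProd (n + 1)).const_mul γ₀)

/-- The sine modes diagonalize the squared Hamiltonian on the odd sublattice. -/
theorem evenMode_add_evenMode (γ₀ γ₁ : ℝ) (n : ℕ) (k : ℝ) :
    γ₀ * evenMode γ₀ γ₁ n k + γ₁ * evenMode γ₀ γ₁ (n + 1) k
      = bandEnergy γ₀ γ₁ k ^ 2 * sinProd (n + 1) k := by
  rw [sq_bandEnergy, evenMode, evenMode]
  linear_combination γ₀ * γ₁ * sinProd_add_sinProd n k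

/-! ### Matrix elements of the inverse of the squared Hamiltonian -/

/-- The integral of `sinProd n / E²`, where `E` is the band energy: up to the factor `2 / π`, a
matrix element of the inverse of the squared Hamiltonian on the odd sublattice. -/
noncomputable def invSqElement (γ₀ γ₁ : ℝ) (n : ℕ) : ℝ :=
  ∫ k in Ioo 0 Real.pi, sinProd n k / bandEnergy γ₀ γ₁ k ^ 2

theorem invSqElement_zero (γ₀ γ₁ : ℝ) : invSqElement γ₀ γ₁ 0 = 0 := by
  simp [invSqElement, sinProd_zero]

theorem invSqElement_comm (γ₀ γ₁ : ℝ) (n : ℕ) :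
    invSqElement γ₀ γ₁ n = invSqElement γ₁ γ₀ n := by
  simp_rw [invSqElement, bandEnergy_comm γ₀ γ₁]

/-- If `|γ₀| = |γ₁|` the band touches zero at an end of `[0, π]`; the two sine factors of `sinProd`
compensate two powers of `1 / E`, since `|γ₁ sin k| ≤ E`. -/
theorem integrableOn_sinProd_div_pow {γ₀ γ₁ : ℝ} (h₁ : γ₁ ≠ 0) (n : ℕ) {p : ℕ} (hp : p ≤ 2) :
    IntegrableOn (fun k => sinProd n k / bandEnergy γ₀ γ₁ k ^ p) (Ioo 0 Real.pi) := by
  have : IsFiniteMeasure (volume.restrict (Ioo 0 Real.pi)) := ⟨by simp⟩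
  refine Integrable.of_bound (((continuous_sinProd n).measurable.div
    ((continuous_bandEnergy γ₀ γ₁).measurable.pow_const p)).aestronglyMeasurable)
    (n / |γ₁| ^ p) ?_
  filter_upwards [ae_restrict_mem measurableSet_Ioo] with k hk
  have hE := bandEnergy_pos (γ₀ := γ₀) h₁ hk
  have h1 : 0 < |γ₁| := abs_pos.2 h₁
  have hs : |γ₁| * |Real.sin k| ≤ bandEnergy γ₀ γ₁ k := by
    rw [← abs_mul]
    refine abs_le_of_sq_le_sq ?_ hE.le
    rw [mul_pow]
    exact mul_sin_sq_le_sq_bandEnergy γ₀ γ₁ k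
  rw [Real.norm_eq_abs, abs_div, abs_of_pos (pow_pos hE p), div_le_div_iff₀ (pow_pos hE p)
    (pow_pos h1 p)]
  have h2 : |sinProd n k| ≤ n * |Real.sin k| ^ p := by
    rw [sinProd, abs_mul]
    calc |Real.sin (n * k)| * |Real.sin k| ≤ n * |Real.sin k| * |Real.sin k| :=
          mul_le_mul_of_nonneg_right (abs_sin_nat_mul_le n k) (abs_nonneg _)
      _ = n * |Real.sin k| ^ 2 := by ring
      _ ≤ n * |Real.sin k| ^ p := mul_le_mul_of_nonneg_left
          (pow_le_pow_of_le_one (abs_nonneg _) (Real.abs_sin_le_one k) hp) (Nat.cast_nonneg n)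
  calc |sinProd n k| * |γ₁| ^ p ≤ n * |Real.sin k| ^ p * |γ₁| ^ p :=
        mul_le_mul_of_nonneg_right h2 (by positivity)
    _ = n * (|γ₁| * |Real.sin k|) ^ p := by rw [mul_pow]; ring
    _ ≤ n * bandEnergy γ₀ γ₁ k ^ p := by gcongr

theorem integrableOn_evenMode_div_sq {γ₀ γ₁ : ℝ} (h₁ : γ₁ ≠ 0) (n : ℕ) :
    IntegrableOn (fun k => evenMode γ₀ γ₁ n k / bandEnergy γ₀ γ₁ k ^ 2) (Ioo 0 Real.pi) := by
  have i := fun m => integrableOn_sinProd_div_pow (γ₀ := γ₀) h₁ m (le_refl 2)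
  refine (((i n).const_mul γ₁).add ((i (n + 1)).const_mul γ₀)).congr
    (Eventually.of_forall fun k => ?_)
  simp only [evenMode, Pi.add_apply]
  ring

theorem setIntegral_evenMode_div_sq {γ₀ γ₁ : ℝ} (h₁ : γ₁ ≠ 0) (n : ℕ) :
    ∫ k in Ioo 0 Real.pi, evenMode γ₀ γ₁ n k / bandEnergy γ₀ γ₁ k ^ 2
      = γ₁ * invSqElement γ₀ γ₁ n + γ₀ * invSqElement γ₀ γ₁ (n + 1) := by
  have i := fun m => integrableOn_sinProd_div_pow (γ₀ := γ₀) h₁ m (le_refl 2)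
  rw [invSqElement, invSqElement, ← integral_const_mul, ← integral_const_mul,
    ← integral_add ((i _).const_mul _) ((i _).const_mul _)]
  refine setIntegral_congr_fun measurableSet_Ioo fun k _ => ?_
  simp only [evenMode]
  ring

theorem invSqElement_recurrence {γ₀ γ₁ : ℝ} (h₁ : γ₁ ≠ 0) (n : ℕ) :
    γ₀ * (γ₁ * invSqElement γ₀ γ₁ n + γ₀ * invSqElement γ₀ γ₁ (n + 1)) +
      γ₁ * (γ₁ * invSqElement γ₀ γ₁ (n + 1) + γ₀ * invSqElement γ₀ γ₁ (n + 2))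
      = if n = 0 then Real.pi / 2 else 0 := by
  have i := integrableOn_evenMode_div_sq (γ₀ := γ₀) h₁
  rw [← setIntegral_sinProd_succ, ← setIntegral_evenMode_div_sq h₁,
    ← setIntegral_evenMode_div_sq h₁, ← integral_const_mul, ← integral_const_mul,
    ← integral_add ((i _).const_mul _) ((i _).const_mul _)]
  refine setIntegral_congr_fun measurableSet_Ioo fun k hk => ?_
  have hE := (bandEnergy_pos (γ₀ := γ₀) h₁ hk).ne'
  have := evenMode_add_evenMode γ₀ γ₁ n k
  field_simp
  linear_combination this

theorem abs_invSqElement_le {γ₀ γ₁ : ℝ} (h : |γ₁| ≠ |γ₀|) (n : ℕ) :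
    |invSqElement γ₀ γ₁ n| ≤ 1 / (|γ₀| - |γ₁|) ^ 2 * Real.pi := by
  have h0 : 0 < (|γ₀| - |γ₁|) ^ 2 := by
    have : |γ₀| - |γ₁| ≠ 0 := sub_ne_zero.2 h.symm
    positivity
  have := norm_setIntegral_le_of_norm_le_const (μ := volume) (s := Ioo 0 Real.pi)
    (f := fun k => sinProd n k / bandEnergy γ₀ γ₁ k ^ 2) (C := 1 / (|γ₀| - |γ₁|) ^ 2)
    measure_Ioo_lt_top fun k _ => ?_
  · simpa [invSqElement, Real.pi_pos.le, Measure.real] using this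
  · rw [norm_div, Real.norm_eq_abs, Real.norm_eq_abs,
      abs_of_nonneg (sq_nonneg (bandEnergy γ₀ γ₁ k))]
    refine div_le_div₀ zero_le_one (abs_sinProd_le_one n k) h0 ?_
    rw [sq_bandEnergy, sub_sq, sq_abs, sq_abs]
    have h1 : |γ₀ * γ₁ * Real.cos k| ≤ |γ₀| * |γ₁| := by
      rw [abs_mul, abs_mul]
      exact mul_le_of_le_one_right (by positivity) (Real.abs_cos_le_one k)
    linarith [neg_abs_le (γ₀ * γ₁ * Real.cos k)]

/-! ### The stationary part of the walk -/

/-- The long-time limit of the amplitude at the even site `2 n`. -/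
noncomputable def evenLimit (γ₀ γ₁ : ℝ) (n : ℕ) : ℝ :=
  (if n = 0 then 1 else 0) - 2 * γ₀ / Real.pi *
    (γ₁ * invSqElement γ₀ γ₁ n + γ₀ * invSqElement γ₀ γ₁ (n + 1))

/-- The limiting configuration is a zero mode of the Hamiltonian, hence geometric. -/
theorem evenLimit_eq_pow_mul {γ₀ γ₁ : ℝ} (h₁ : γ₁ ≠ 0) (n : ℕ) :
    evenLimit γ₀ γ₁ n = (-(γ₀ / γ₁)) ^ n * evenLimit γ₀ γ₁ 0 := by
  induction n with
  | zero => simp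
  | succ n ih =>
    rw [pow_succ, mul_right_comm, ← ih]
    have h := invSqElement_recurrence (γ₀ := γ₀) h₁ n
    have hpi := Real.pi_ne_zero
    simp only [evenLimit, Nat.succ_ne_zero, if_false, Nat.add_assoc]
    norm_num
    field_simp
    split_ifs at h ⊢ <;> linear_combination 2 * γ₀ * h

/-- If `|γ₁| < |γ₀|`, the limiting configuration is both bounded and a multiple of a growing
geometric sequence, so it vanishes; at the origin this evaluates the integral. -/
theorem invSqElement_one_of_lt {γ₀ γ₁ : ℝ} (h₁ : γ₁ ≠ 0) (h : |γ₁| < |γ₀|) :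
    invSqElement γ₀ γ₁ 1 = Real.pi / (2 * γ₀ ^ 2) := by
  have h₀ : γ₀ ≠ 0 := abs_pos.1 ((abs_nonneg _).trans_lt h)
  obtain ⟨D, hD⟩ : ∃ D, ∀ n, |evenLimit γ₀ γ₁ n| ≤ D := by
    set K := 1 / (|γ₀| - |γ₁|) ^ 2 * Real.pi
    refine ⟨1 + |2 * γ₀ / Real.pi| * (|γ₁| * K + |γ₀| * K), fun n => ?_⟩
    have hJ := abs_invSqElement_le h.ne
    refine (abs_sub _ _).trans (add_le_add (by split_ifs <;> simp) ?_)
    rw [abs_mul]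
    gcongr
    refine (abs_add_le _ _).trans ?_
    rw [abs_mul, abs_mul]
    gcongr <;> exact hJ _
  have hr : |γ₁ / γ₀| < 1 := by
    rw [abs_div]; exact (div_lt_one (abs_pos.2 h₀)).2 h
  have hle : ∀ n : ℕ, |evenLimit γ₀ γ₁ 0| ≤ |γ₁ / γ₀| ^ n * D := by
    intro n
    have e : evenLimit γ₀ γ₁ 0 = (-(γ₁ / γ₀)) ^ n * evenLimit γ₀ γ₁ n := by
      rw [evenLimit_eq_pow_mul h₁ n, ← mul_assoc, ← mul_pow]
      have : -(γ₁ / γ₀) * -(γ₀ / γ₁) = 1 := by field_simp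
      rw [this, one_pow, one_mul]
    rw [e, abs_mul, abs_pow, abs_neg]
    gcongr
    exact hD n
  have hlim := (tendsto_pow_atTop_nhds_zero_of_lt_one (abs_nonneg _) hr).mul_const D
  have h0 : evenLimit γ₀ γ₁ 0 = 0 := by
    have := ge_of_tendsto' hlim hle
    rw [zero_mul] at this
    exact abs_nonpos_iff.1 this
  have hpi := Real.pi_ne_zero
  simp only [evenLimit, if_true, invSqElement_zero, mul_zero, zero_add] at h0
  field_simp at h0 ⊢
  linarith

/-- With `γ₁ = ε γ₀` and `ε² = 1`, the factor `1 + ε cos k` of `E²` cancels against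
`sin² k = (1 + ε cos k) (1 - ε cos k)`. -/
theorem invSqElement_one_of_abs_eq {γ₀ γ₁ : ℝ} (h₀ : γ₀ ≠ 0) (h : |γ₁| = |γ₀|) :
    invSqElement γ₀ γ₁ 1 = Real.pi / (2 * γ₀ ^ 2) := by
  obtain ⟨ε, hε, rfl⟩ : ∃ ε : ℝ, ε ^ 2 = 1 ∧ γ₁ = ε * γ₀ := by
    rcases abs_eq_abs.1 h with h | h
    exacts [⟨1, by simp, by simp [h]⟩, ⟨-1, by simp, by simp [h]⟩]
  have h₁ : ε * γ₀ ≠ 0 := by rw [← abs_pos, h]; exact abs_pos.2 h₀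
  have e : ∀ k ∈ Ioo 0 Real.pi, sinProd 1 k / bandEnergy γ₀ (ε * γ₀) k ^ 2
      = 1 / (2 * γ₀ ^ 2) * (1 - ε * Real.cos k) := by
    intro k hk
    have hE := (pow_pos (bandEnergy_pos (γ₀ := γ₀) h₁ hk) 2).ne'
    rw [div_eq_iff hE, sq_bandEnergy, sinProd]
    field_simp
    push_cast
    rw [one_mul]
    linear_combination 2 * Real.sin_sq_add_cos_sq k +
      (-1 + ε * Real.cos k + 2 * Real.cos k ^ 2) * hε
  rw [invSqElement, setIntegral_congr_fun measurableSet_Ioo e, integral_const_mul,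
    integral_sub (integrableOn_of_continuous (by fun_prop))
    (integrableOn_of_continuous (by fun_prop)), integral_const_mul]
  have := setIntegral_cos_nat_mul 1
  simp only [Nat.cast_one, one_mul, one_ne_zero, if_false] at this
  rw [this]
  simp [Real.pi_pos.le, Measure.real]
  ring

theorem evenLimit_eq {γ₀ γ₁ : ℝ} (h₀ : γ₀ ≠ 0) (h₁ : γ₁ ≠ 0) (n : ℕ) :
    evenLimit γ₀ γ₁ n =
      if |γ₀| < |γ₁| then (-(γ₀ / γ₁)) ^ n * (1 - (γ₀ / γ₁) ^ 2) else 0 := by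
  have hpi := Real.pi_ne_zero
  rw [evenLimit_eq_pow_mul h₁ n]
  simp only [evenLimit, if_true, invSqElement_zero, mul_zero, zero_add]
  split_ifs with h
  · rw [invSqElement_comm, invSqElement_one_of_lt h₀ h]
    field_simp
  · have e : invSqElement γ₀ γ₁ 1 = Real.pi / (2 * γ₀ ^ 2) := by
      rcases (not_lt.1 h).lt_or_eq with h | h
      exacts [invSqElement_one_of_lt h₁ h, invSqElement_one_of_abs_eq h₀ h]
    rw [e]
    field_simp
    simp

/-! ### The explicit amplitudes -/

/-- The spectral form of the amplitude: `-i * oddAmp γ₀ γ₁ (n + 1) t` is the amplitude at the odd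
site `2 n + 1`. -/
noncomputable def oddAmp (γ₀ γ₁ : ℝ) (n : ℕ) (t : ℝ) : ℝ :=
  2 * γ₀ / Real.pi * ∫ k in Ioo 0 Real.pi,
    Real.sin (t * bandEnergy γ₀ γ₁ k) / bandEnergy γ₀ γ₁ k * sinProd n k

/-- The spectral form of the amplitude at the even site `2 n`. -/
noncomputable def evenAmp (γ₀ γ₁ : ℝ) (n : ℕ) (t : ℝ) : ℝ :=
  (if n = 0 then 1 else 0) - 2 * γ₀ / Real.pi * ∫ k in Ioo 0 Real.pi,
    (1 - Real.cos (t * bandEnergy γ₀ γ₁ k)) / bandEnergy γ₀ γ₁ k ^ 2 * evenMode γ₀ γ₁ n k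

section
variable {γ₀ γ₁ : ℝ}

theorem oddAmp_zero_left (t : ℝ) : oddAmp γ₀ γ₁ 0 t = 0 := by
  simp [oddAmp, sinProd_zero]

theorem oddAmp_zero_right (n : ℕ) : oddAmp γ₀ γ₁ n 0 = 0 := by simp [oddAmp]

theorem evenAmp_zero_right (n : ℕ) : evenAmp γ₀ γ₁ n 0 = if n = 0 then 1 else 0 := by
  simp [evenAmp]

theorem ae_bandEnergy_ne_zero (h₁ : γ₁ ≠ 0) :
    ∀ᵐ k ∂volume.restrict (Ioo 0 Real.pi), bandEnergy γ₀ γ₁ k ≠ 0 := by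
  filter_upwards [ae_restrict_mem measurableSet_Ioo] with k hk
  exact (bandEnergy_pos h₁ hk).ne'

theorem hasDerivAt_evenAmp (h₁ : γ₁ ≠ 0) (n : ℕ) (t : ℝ) :
    HasDerivAt (evenAmp γ₀ γ₁ n)
      (-(γ₁ * oddAmp γ₀ γ₁ n t + γ₀ * oddAmp γ₀ γ₁ (n + 1) t)) t := by
  have hE := (continuous_bandEnergy γ₀ γ₁).aemeasurable (μ := volume.restrict (Ioo 0 Real.pi))
  have h := ((hasDerivAt_integral_one_sub_cos_mul_div hE (ae_bandEnergy_ne_zero h₁)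
    (integrableOn_evenMode γ₀ γ₁ n) t).const_mul (2 * γ₀ / Real.pi)).const_sub
    (if n = 0 then 1 else 0)
  refine h.congr_deriv ?_
  have i := fun m => integrable_sin_mul_div hE (integrableOn_sinProd m) t
  have e : ∫ k in Ioo 0 Real.pi, Real.sin (t * bandEnergy γ₀ γ₁ k) / bandEnergy γ₀ γ₁ k *
      evenMode γ₀ γ₁ n k = γ₁ * (∫ k in Ioo 0 Real.pi, Real.sin (t * bandEnergy γ₀ γ₁ k) /
        bandEnergy γ₀ γ₁ k * sinProd n k) + γ₀ * ∫ k in Ioo 0 Real.pi,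
        Real.sin (t * bandEnergy γ₀ γ₁ k) / bandEnergy γ₀ γ₁ k * sinProd (n + 1) k := by
    rw [← integral_const_mul, ← integral_const_mul,
      ← integral_add ((i _).const_mul _) ((i _).const_mul _)]
    refine integral_congr_ae (Eventually.of_forall fun k => ?_)
    simp only [evenMode]
    ring
  rw [e, oddAmp, oddAmp]
  ring

theorem hasDerivAt_oddAmp_succ (h₁ : γ₁ ≠ 0) (n : ℕ) (t : ℝ) :
    HasDerivAt (oddAmp γ₀ γ₁ (n + 1))
      (γ₀ * evenAmp γ₀ γ₁ n t + γ₁ * evenAmp γ₀ γ₁ (n + 1) t) t := by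
  have hE := (continuous_bandEnergy γ₀ γ₁).aemeasurable (μ := volume.restrict (Ioo 0 Real.pi))
  have h := (hasDerivAt_integral_sin_mul_div hE (ae_bandEnergy_ne_zero h₁)
    (integrableOn_sinProd (n + 1)) t).const_mul (2 * γ₀ / Real.pi)
  refine h.congr_deriv ?_
  have i := fun m => integrable_one_sub_cos_mul_div hE (integrableOn_evenMode γ₀ γ₁ m) t
  have e : γ₀ * (∫ k in Ioo 0 Real.pi, (1 - Real.cos (t * bandEnergy γ₀ γ₁ k)) /
      bandEnergy γ₀ γ₁ k ^ 2 * evenMode γ₀ γ₁ n k) + γ₁ * (∫ k in Ioo 0 Real.pi,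
      (1 - Real.cos (t * bandEnergy γ₀ γ₁ k)) / bandEnergy γ₀ γ₁ k ^ 2 *
        evenMode γ₀ γ₁ (n + 1) k) = (if n = 0 then Real.pi / 2 else 0) -
      ∫ k in Ioo 0 Real.pi, Real.cos (t * bandEnergy γ₀ γ₁ k) * sinProd (n + 1) k := by
    rw [← setIntegral_sinProd_succ, ← integral_const_mul, ← integral_const_mul,
      ← integral_add ((i _).const_mul _) ((i _).const_mul _),
      ← integral_sub (integrableOn_sinProd _) (integrable_cos_mul hE (integrableOn_sinProd _) t)]
    refine setIntegral_congr_fun measurableSet_Ioo fun k hk => ?_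
    have hE := (bandEnergy_pos (γ₀ := γ₀) h₁ hk).ne'
    have := evenMode_add_evenMode γ₀ γ₁ n k
    field_simp
    linear_combination (1 - Real.cos (t * bandEnergy γ₀ γ₁ k)) * this
  have hpi := inv_mul_cancel₀ Real.pi_ne_zero
  simp only [evenAmp, Nat.succ_ne_zero, if_false]
  split_ifs at e ⊢
  · linear_combination 2 * γ₀ / Real.pi * e + γ₀ * hpi
  · linear_combination 2 * γ₀ / Real.pi * e

theorem abs_oddAmp_le (n : ℕ) (t : ℝ) :
    |oddAmp γ₀ γ₁ n t| ≤ |2 * γ₀ / Real.pi| * (|t| * Real.pi) := by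
  rw [oddAmp, abs_mul]
  gcongr
  have := norm_setIntegral_le_of_norm_le_const (μ := volume) (s := Ioo 0 Real.pi)
    (f := fun k => Real.sin (t * bandEnergy γ₀ γ₁ k) / bandEnergy γ₀ γ₁ k * sinProd n k)
    (C := |t|) measure_Ioo_lt_top fun k _ => ?_
  · simpa [Real.pi_pos.le, Measure.real] using this
  · rw [Real.norm_eq_abs, abs_mul]
    exact (mul_le_of_le_one_right (abs_nonneg _) (abs_sinProd_le_one n k)).trans
      (abs_sin_mul_div_le _ _)

theorem abs_evenMode_le (n : ℕ) (k : ℝ) : |evenMode γ₀ γ₁ n k| ≤ |γ₁| + |γ₀| := by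
  refine (abs_add_le _ _).trans ?_
  rw [abs_mul, abs_mul]
  exact add_le_add (mul_le_of_le_one_right (abs_nonneg _) (abs_sinProd_le_one _ _))
    (mul_le_of_le_one_right (abs_nonneg _) (abs_sinProd_le_one _ _))

theorem abs_evenAmp_le (n : ℕ) (t : ℝ) :
    |evenAmp γ₀ γ₁ n t| ≤
      1 + |2 * γ₀ / Real.pi| * (t ^ 2 / 2 * (|γ₁| + |γ₀|) * Real.pi) := by
  refine (abs_sub _ _).trans (add_le_add (by split_ifs <;> simp) ?_)
  rw [abs_mul]
  gcongr
  have := norm_setIntegral_le_of_norm_le_const (μ := volume) (s := Ioo 0 Real.pi)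
    (f := fun k => (1 - Real.cos (t * bandEnergy γ₀ γ₁ k)) / bandEnergy γ₀ γ₁ k ^ 2 *
      evenMode γ₀ γ₁ n k) (C := t ^ 2 / 2 * (|γ₁| + |γ₀|)) measure_Ioo_lt_top fun k _ => ?_
  · simpa [Real.pi_pos.le, Measure.real] using this
  · rw [Real.norm_eq_abs, abs_mul]
    exact mul_le_mul (abs_one_sub_cos_mul_div_le _ _) (abs_evenMode_le n k) (abs_nonneg _)
      (by positivity)

/-! ### Long-time limits of the explicit amplitudes -/

theorem phase_deriv_ne_zero (h₀ : γ₀ ≠ 0) (h₁ : γ₁ ≠ 0) {k : ℝ} (hk : k ∈ Ioo 0 Real.pi) :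
    -(2 * γ₀ * γ₁ * Real.sin k) / (2 * bandEnergy γ₀ γ₁ k) ≠ 0 := by
  have := (bandEnergy_pos (γ₀ := γ₀) h₁ hk).ne'
  have := (Real.sin_pos_of_mem_Ioo hk).ne'
  simp_all

theorem tendsto_oddAmp (h₀ : γ₀ ≠ 0) (h₁ : γ₁ ≠ 0) (n : ℕ) :
    Tendsto (oddAmp γ₀ γ₁ n) atTop (𝓝 0) := by
  have h := (tendsto_setIntegral_sin_phase measurableSet_Ioo
    (fun k hk => (hasDerivAt_bandEnergy (γ₀ := γ₀) h₁ hk).hasDerivWithinAt)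
    (injOn_bandEnergy h₀ h₁) (fun k hk => phase_deriv_ne_zero h₀ h₁ hk)
    (integrableOn_sinProd_div_pow (γ₀ := γ₀) h₁ n one_le_two)).const_mul (2 * γ₀ / Real.pi)
  rw [mul_zero] at h
  refine h.congr fun t => ?_
  rw [oddAmp]
  congr 2
  ext k
  ring

theorem tendsto_evenAmp (h₀ : γ₀ ≠ 0) (h₁ : γ₁ ≠ 0) (n : ℕ) :
    Tendsto (evenAmp γ₀ γ₁ n) atTop (𝓝 (evenLimit γ₀ γ₁ n)) := by
  have hE := (continuous_bandEnergy γ₀ γ₁).aemeasurable (μ := volume.restrict (Ioo 0 Real.pi))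
  have i := integrableOn_evenMode_div_sq (γ₀ := γ₀) h₁ n
  have h := tendsto_setIntegral_cos_phase measurableSet_Ioo
    (fun k hk => (hasDerivAt_bandEnergy (γ₀ := γ₀) h₁ hk).hasDerivWithinAt)
    (injOn_bandEnergy h₀ h₁) (fun k hk => phase_deriv_ne_zero h₀ h₁ hk) i
  have h2 := ((h.const_sub (∫ k in Ioo 0 Real.pi, evenMode γ₀ γ₁ n k /
    bandEnergy γ₀ γ₁ k ^ 2)).const_mul (2 * γ₀ / Real.pi)).const_sub (if n = 0 then 1 else 0)
  rw [sub_zero, setIntegral_evenMode_div_sq h₁] at h2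
  refine h2.congr fun t => ?_
  rw [evenAmp, ← setIntegral_evenMode_div_sq h₁, ← integral_sub i (integrable_cos_mul hE i t)]
  congr 3
  ext k
  ring
end

/-! ### Identification of the walk -/

/-- The Hamiltonian of the walk, acting on arbitrary configurations. -/
noncomputable def walkHamiltonian (γ₀ γ₁ : ℝ) (w : ℕ → ℂ) : ℕ → ℂ
  | 0 => γ₀ * w 1
  | x + 1 => if Even x then γ₀ * w x + γ₁ * w (x + 2) else γ₁ * w x + γ₀ * w (x + 2)

theorem walkHamiltonian_odd (γ₀ γ₁ : ℝ) (w : ℕ → ℂ) (n : ℕ) :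
    walkHamiltonian γ₀ γ₁ w (2 * n + 1) = γ₀ * w (2 * n) + γ₁ * w (2 * n + 2) := by
  simp [walkHamiltonian]

theorem walkHamiltonian_even_succ (γ₀ γ₁ : ℝ) (w : ℕ → ℂ) (n : ℕ) :
    walkHamiltonian γ₀ γ₁ w (2 * (n + 1)) = γ₁ * w (2 * n + 1) + γ₀ * w (2 * n + 3) := by
  have : ¬ Even (2 * n + 1) := by simp
  simp [walkHamiltonian, Nat.mul_add, this]

theorem walkHamiltonian_sub (γ₀ γ₁ : ℝ) (w w' : ℕ → ℂ) (x : ℕ) :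
    walkHamiltonian γ₀ γ₁ (fun y => w y - w' y) x
      = walkHamiltonian γ₀ γ₁ w x - walkHamiltonian γ₀ γ₁ w' x := by
  cases x with
  | zero => simp only [walkHamiltonian]; ring
  | succ x => simp only [walkHamiltonian]; split_ifs <;> ring

theorem norm_walkHamiltonian_le (γ₀ γ₁ : ℝ) {w : ℕ → ℂ} {B : ℝ} (hB : ∀ y, ‖w y‖ ≤ B) (x : ℕ) :
    ‖walkHamiltonian γ₀ γ₁ w x‖ ≤ (|γ₀| + |γ₁|) * B := by
  have h : ∀ (γ : ℝ) y, ‖(γ : ℂ) * w y‖ ≤ |γ| * B := fun γ y => by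
    rw [norm_mul, Complex.norm_real, Real.norm_eq_abs]
    exact mul_le_mul_of_nonneg_left (hB y) (abs_nonneg _)
  have hB0 : 0 ≤ |γ₁| * B := mul_nonneg (abs_nonneg _) ((norm_nonneg _).trans (hB 0))
  rw [add_mul]
  cases x with
  | zero => exact (h γ₀ 1).trans (by linarith)
  | succ x =>
    simp only [walkHamiltonian]
    split_ifs
    · exact (norm_add_le _ _).trans (add_le_add (h _ _) (h _ _))
    · rw [add_comm (|γ₀| * B)]
      exact (norm_add_le _ _).trans (add_le_add (h _ _) (h _ _))

theorem IsHalfLineWalk.hasDerivWithinAt {γ₀ γ₁ : ℝ} {ψ : ℝ → ℕ → ℂ}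
    (hψ : IsHalfLineWalk γ₀ γ₁ ψ) {t : ℝ} (ht : 0 ≤ t) (x : ℕ) :
    HasDerivWithinAt (fun s => ψ s x) (-Complex.I * walkHamiltonian γ₀ γ₁ (ψ t) x) (Ici 0) t := by
  have key : HasDerivWithinAt (fun s => Complex.I * ψ s x) (walkHamiltonian γ₀ γ₁ (ψ t) x)
      (Ici 0) t := by
    obtain ⟨n, rfl | rfl⟩ := x.even_or_odd'
    · cases n with
      | zero => exact hψ.edge t ht
      | succ n =>
        rw [walkHamiltonian_even_succ]
        exact hψ.even t ht (n + 1) (by omega)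
    · rw [walkHamiltonian_odd]
      exact hψ.odd t ht n
  refine (key.const_mul (-Complex.I)).congr_of_mem (fun s _ => ?_) ht
  rw [← mul_assoc, neg_mul, Complex.I_mul_I, neg_neg, one_mul]

theorem IsHalfLineWalk.norm_le_one {γ₀ γ₁ : ℝ} {ψ : ℝ → ℕ → ℂ}
    (hψ : IsHalfLineWalk γ₀ γ₁ ψ) {t : ℝ} (ht : 0 ≤ t) (x : ℕ) : ‖ψ t x‖ ≤ 1 := by
  have h := le_hasSum (hψ.normalized t ht) x fun y _ => by positivity
  exact (sq_le_one_iff₀ (norm_nonneg _)).1 h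

/-- The explicit configuration: `evenAmp` on the even and `-i * oddAmp` on the odd sublattice. -/
noncomputable def walkAmp (γ₀ γ₁ t : ℝ) (x : ℕ) : ℂ :=
  if Even x then (evenAmp γ₀ γ₁ (x / 2) t : ℂ)
  else -Complex.I * (oddAmp γ₀ γ₁ (x / 2 + 1) t : ℂ)

theorem walkAmp_even (γ₀ γ₁ t : ℝ) (n : ℕ) : walkAmp γ₀ γ₁ t (2 * n) = evenAmp γ₀ γ₁ n t := by
  simp [walkAmp]

theorem walkAmp_odd (γ₀ γ₁ t : ℝ) (n : ℕ) :
    walkAmp γ₀ γ₁ t (2 * n + 1) = -Complex.I * oddAmp γ₀ γ₁ (n + 1) t := by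
  have : (2 * n + 1) / 2 = n := by omega
  simp [walkAmp, this]

theorem hasDerivAt_walkAmp {γ₀ γ₁ : ℝ} (h₁ : γ₁ ≠ 0) (t : ℝ) (x : ℕ) :
    HasDerivAt (fun s => walkAmp γ₀ γ₁ s x)
      (-Complex.I * walkHamiltonian γ₀ γ₁ (walkAmp γ₀ γ₁ t) x) t := by
  have hI := Complex.I_sq
  obtain ⟨n, rfl | rfl⟩ := x.even_or_odd'
  · simp only [walkAmp_even]
    refine (hasDerivAt_evenAmp h₁ n t).ofReal_comp.congr_deriv ?_
    cases n with
    | zero =>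
      have h := walkAmp_odd γ₀ γ₁ t 0
      simp only [mul_zero, zero_add] at h ⊢
      simp only [walkHamiltonian, h, oddAmp_zero_left]
      push_cast
      linear_combination (-(γ₀ * oddAmp γ₀ γ₁ 1 t) : ℂ) * hI
    | succ n =>
      have h := walkAmp_odd γ₀ γ₁ t (n + 1)
      rw [walkHamiltonian_even_succ, walkAmp_odd, show 2 * n + 3 = 2 * (n + 1) + 1 by ring, h]
      push_cast
      linear_combination
        (-(γ₁ * oddAmp γ₀ γ₁ (n + 1) t + γ₀ * oddAmp γ₀ γ₁ (n + 1 + 1) t) : ℂ) * hI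
  · simp only [walkAmp_odd]
    refine ((hasDerivAt_oddAmp_succ h₁ n t).ofReal_comp.const_mul (-Complex.I)).congr_deriv ?_
    rw [walkHamiltonian_odd, walkAmp_even, show 2 * n + 2 = 2 * (n + 1) by ring, walkAmp_even]
    push_cast
    ring

/-- On a bounded time interval the explicit configuration is bounded uniformly in the sites. -/
theorem exists_norm_walkAmp_le (γ₀ γ₁ T : ℝ) :
    ∃ M, ∀ t ∈ Icc 0 T, ∀ x, ‖walkAmp γ₀ γ₁ t x‖ ≤ M := by
  refine ⟨|2 * γ₀ / Real.pi| * (T * Real.pi) +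
    (1 + |2 * γ₀ / Real.pi| * (T ^ 2 / 2 * (|γ₁| + |γ₀|) * Real.pi)), fun t ht x => ?_⟩
  have hpi := Real.pi_pos
  have hT : 0 ≤ T := ht.1.trans ht.2
  obtain ⟨n, rfl | rfl⟩ := x.even_or_odd'
  · rw [walkAmp_even, Complex.norm_real, Real.norm_eq_abs]
    refine (abs_evenAmp_le n t).trans ((le_add_of_nonneg_left (by positivity)).trans' ?_)
    have := ht.1
    gcongr
    exact ht.2
  · rw [walkAmp_odd, norm_mul, norm_neg, Complex.norm_I, one_mul, Complex.norm_real,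
      Real.norm_eq_abs]
    refine (abs_oddAmp_le (n + 1) t).trans ((le_add_of_nonneg_right (by positivity)).trans' ?_)
    rw [abs_of_nonneg ht.1]
    gcongr
    exact ht.2

theorem IsHalfLineWalk.eq_walkAmp {γ₀ γ₁ : ℝ} {ψ : ℝ → ℕ → ℂ} (h₁ : γ₁ ≠ 0)
    (hψ : IsHalfLineWalk γ₀ γ₁ ψ) {t : ℝ} (ht : 0 ≤ t) (x : ℕ) :
    ψ t x = walkAmp γ₀ γ₁ t x := by
  obtain ⟨M, hM⟩ := exists_norm_walkAmp_le γ₀ γ₁ t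
  refine sub_eq_zero.1 (eq_zero_of_norm_deriv_le_sup (u := fun t x => ψ t x - walkAmp γ₀ γ₁ t x)
    (v := fun t x => -Complex.I * walkHamiltonian γ₀ γ₁ (fun y => ψ t y - walkAmp γ₀ γ₁ t y) x)
    (c := |γ₀| + |γ₁|) (M := 1 + M) (T := t) (fun x => ?_) (fun s hs x => ?_)
    (fun s hs B hB x => ?_) (fun s hs x => ?_) ⟨ht, le_rfl⟩ x)
  · rw [hψ.initial]
    obtain ⟨n, rfl | rfl⟩ := x.even_or_odd'
    · rw [walkAmp_even, evenAmp_zero_right]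
      split_ifs <;> simp_all
    · simp [walkAmp_odd, oddAmp_zero_right]
  · rw [walkHamiltonian_sub, mul_sub]
    exact (hψ.hasDerivWithinAt hs x).sub (hasDerivAt_walkAmp h₁ s x).hasDerivWithinAt
  · rw [norm_mul, norm_neg, Complex.norm_I, one_mul]
    exact norm_walkHamiltonian_le γ₀ γ₁ hB x
  · exact (norm_sub_le _ _).trans (add_le_add (hψ.norm_le_one hs.1 x) (hM s hs x))

theorem theorem1 (γ₀ γ₁ : ℝ) (hγ₀ : γ₀ ≠ 0) (hγ₁ : γ₁ ≠ 0)
    (ψ : ℝ → ℕ → ℂ) (hψ : IsHalfLineWalk γ₀ γ₁ ψ) :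
    (∀ n : ℕ,
      Tendsto (fun t : ℝ => findProb ψ t (2 * n)) atTop
        (𝓝 (if |γ₀| < |γ₁| then (1 - (γ₀ / γ₁) ^ 2) ^ 2 * (γ₀ / γ₁) ^ (2 * n) else 0)) ∧
      Tendsto (fun t : ℝ => findProb ψ t (2 * n + 1)) atTop (𝓝 0)) ∧
    (IsLocalized ψ ↔ |γ₀| < |γ₁|) := by
  have heven : ∀ n : ℕ, Tendsto (fun t : ℝ => findProb ψ t (2 * n)) atTop
      (𝓝 (if |γ₀| < |γ₁| then (1 - (γ₀ / γ₁) ^ 2) ^ 2 * (γ₀ / γ₁) ^ (2 * n) else 0)) := by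
    intro n
    have h := (tendsto_evenAmp hγ₀ hγ₁ n).pow 2
    rw [evenLimit_eq hγ₀ hγ₁] at h
    convert h.congr' ?_ using 2
    · split_ifs
      · rw [mul_pow, ← pow_mul, mul_comm n 2, Even.neg_pow (even_two_mul n)]
        ring
      · simp
    · filter_upwards [eventually_ge_atTop 0] with t ht
      rw [findProb, hψ.eq_walkAmp hγ₁ ht, walkAmp_even, Complex.norm_real, Real.norm_eq_abs,
        sq_abs]
  have hodd : ∀ n : ℕ, Tendsto (fun t : ℝ => findProb ψ t (2 * n + 1)) atTop (𝓝 0) := by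
    intro n
    have h := (tendsto_oddAmp hγ₀ hγ₁ (n + 1)).pow 2
    rw [zero_pow two_ne_zero] at h
    refine h.congr' ?_
    filter_upwards [eventually_ge_atTop 0] with t ht
    rw [findProb, hψ.eq_walkAmp hγ₁ ht, walkAmp_odd, norm_mul, norm_neg, Complex.norm_I, one_mul,
      Complex.norm_real, Real.norm_eq_abs, sq_abs]
  refine ⟨fun n => ⟨heven n, hodd n⟩, fun ⟨x, p, hp, hx⟩ => ?_, fun h => ?_⟩
  · by_contra hlt
    obtain ⟨n, rfl | rfl⟩ := x.even_or_odd'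
    · have := heven n
      rw [if_neg hlt] at this
      exact hp.ne' (tendsto_nhds_unique hx this)
    · exact hp.ne' (tendsto_nhds_unique hx (hodd n))
  · have h0 := heven 0
    rw [if_pos h] at h0
    refine ⟨_, _, ?_, h0⟩
    have h1 : (γ₀ / γ₁) ^ 2 < 1 := by
      rw [div_pow, div_lt_one (by positivity)]
      exact sq_lt_sq.2 h
    have h2 : 0 < 1 - (γ₀ / γ₁) ^ 2 := sub_pos.2 h1
    simpa using pow_pos h2 2
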